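/- **Theorem.** Let $\theta\in(0,\pi/2)$ and $S_\theta=\{z\in\mathbb{C}\setminus\{0\}:|\arg z|<\pi-\theta\}$, where $\arg$ takes values in $(-\pi,\pi]$. For $\lambda=re^{i\tau}\in S_\theta$ with $r=|\lambda|$, $\tau=\arg\lambda$, put $k=\sqrt r\,e^{i(\pi+\tau)/2}$, so that $k^2=-\lambda$ and $\operatorname{Im}k>0$. For $x\in\mathbb{R}^2\setminus\{0\}$ let $$G(x;\lambda)=\frac{i}{4}H^{(1)}_0(k|x|),\qquad G(x;0)=-\frac1{2\pi}\log|x|,$$ where $H^{(1)}_0$ is the Hankel function of the first kind of order $0$, given for $\operatorname{Im}z>0$ by $$H^{(1)}_0(z)=\frac{2e^{iz}}{i\pi}\int_0^\infty e^{2izs}\,s^{-1/2}(1+s)^{-1/2}\,ds,$$ and let $\Gamma(x;\lambda)=(\Gamma_{\alpha\beta}(x;\lambda))_{\alpha,\beta=1}^2$ be the matrix of fundamental solutions (velocity part) of the two-dimensional Stokes resolvent problem $\lambda u-\Delta u+\nabla\phi=0$, $\operatorname{div}u=0$, that is $$\Gamma_{\alpha\beta}(x;\lambda)=G(x;\lambda)\,\delta_{\alpha\beta}-\frac1\lambda\,\partial_{x_\alpha}\partial_{x_\beta}\bigl\{G(x;\lambda)-G(x;0)\bigr\},\qquad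 \alpha,\beta\in\{1,2\}.$$ Then for every integer $\ell\ge1$ there exists a constant $C>0$, depending only on $\theta$ and $\ell$, such that for all $\lambda\in S_\theta$ and all $\alpha,\beta\in\{1,2\}$ the function $\Gamma_{\alpha\beta}(\,\cdot\,;\lambda)$ is smooth on $\mathbb{R}^2\setminus\{0\}$ and $$\bigl|\nabla_x^\ell\,\Gamma_{\alpha\beta}(x;\lambda)\bigr|\le\frac{C}{(1+|\lambda||x|^2)\,|x|^\ell}\qquad\text{for all }x\in\mathbb{R}^2\setminus\{0\}.$$ Here $|\nabla_x^\ell f(x)|$ is the norm of the $\ell$-th Fréchet derivative of $f$ at $x$ as an $\ell$-linear map on Euclidean $\mathbb{R}^2$; any other norm on the tensor of $\ell$-th order partial derivatives of the entries changes only $C$, by a factor depending only on $\ell$. -/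

import Mathlib

open scoped ContDiff

noncomputable section

namespace StokesResolvent

/-- The Euclidean plane. -/
abbrev Plane : Type := EuclideanSpace ℝ (Fin 2)

/-- The open sector of all nonzero complex numbers with `|arg z| < π - θ`. -/
def sector (θ : ℝ) : Set ℂ := {z : ℂ | z ≠ 0 ∧ |z.arg| < Real.pi - θ}

/-- The square root `k = √r * exp (i (π + τ) / 2)` of `-lam`, where `lam = r * exp (i τ)` with
`-π < τ ≤ π`. It lies in the open upper half-plane when `lam` lies in a sector `sector θ`
with `0 < θ`. -/
def waveNumber (lam : ℂ) : ℂ :=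
  (Real.sqrt ‖lam‖ : ℂ) * Complex.exp (Complex.I * ((Real.pi + lam.arg : ℝ) : ℂ) / 2)

/-- The Hankel function of the first kind of real order `ν > -1/2`, on the open upper half-plane
`0 < arg z < π`:
`H_ν(z) = 2^(ν+1) e^(i(z-νπ)) z^ν / (i √π Γ(ν+1/2)) * ∫_0^∞ e^(2izs) s^(ν-1/2) (1+s)^(ν-1/2) ds`.
For these `ν` and `z` the integral converges absolutely. -/
def hankelOne (ν : ℝ) (z : ℂ) : ℂ :=
  (2 : ℂ) ^ ((ν : ℂ) + 1) * Complex.exp (Complex.I * (z - (ν : ℂ) * (Real.pi : ℂ))) * z ^ (ν : ℂ)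
      / (Complex.I * (Real.sqrt Real.pi : ℂ) * (Real.Gamma (ν + 1 / 2) : ℂ))
    * ∫ s in Set.Ioi (0 : ℝ),
        Complex.exp (2 * z * Complex.I * (s : ℂ))
          * ((s ^ (ν - 1 / 2) * (1 + s) ^ (ν - 1 / 2) : ℝ) : ℂ)

/-- The fundamental solution `G(x; lam) = (i/4) H_0(k |x|)` of the scalar Helmholtz equation
`lam u - Δ u = 0` in the plane. -/
def helmholtzFund (lam : ℂ) (x : Plane) : ℂ :=
  Complex.I / 4 * hankelOne 0 (waveNumber lam * (‖x‖ : ℂ))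

/-- The fundamental solution `G(x; 0) = -(1/2π) log |x|` of the Laplace equation in the plane. -/
def laplaceFund (x : Plane) : ℂ :=
  ((-(1 / (2 * Real.pi)) * Real.log ‖x‖ : ℝ) : ℂ)

/-- The partial derivative `∂f/∂x_α`. -/
def partialDeriv (α : Fin 2) (f : Plane → ℂ) (x : Plane) : ℂ :=
  fderiv ℝ f x (EuclideanSpace.single α (1 : ℝ))

/-- The matrix of fundamental solutions (velocity part) of the Stokes resolvent problem:
`Γ_{αβ}(x; lam) = G(x; lam) δ_{αβ} - (1/lam) ∂_α ∂_β (G(x; lam) - G(x; 0))`. -/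
def stokesFund (lam : ℂ) (x : Plane) : Matrix (Fin 2) (Fin 2) ℂ :=
  Matrix.of fun α β =>
    helmholtzFund lam x * (if α = β then 1 else 0)
      - 1 / lam * partialDeriv α
          (partialDeriv β fun y => helmholtzFund lam y - laplaceFund y) x

end StokesResolvent

end

namespace StokesResolvent

open MeasureTheory Set Filter Topology Metric

/-- The moments `∫_0^∞ (cosh u)^n exp (-w cosh u) du`; for `n = 0, 1` these are the modified
Bessel functions `K_0(w)` and `K_1(w)`. -/
noncomputable def besselMoment (n : ℕ) (w : ℂ) : ℂ :=
  ∫ u in Ioi (0 : ℝ), (Real.cosh u : ℂ) ^ n * Complex.exp (-w * Real.cosh u)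

theorem norm_cosh_pow_mul_exp_le {n m : ℕ} (hnm : n < m) {x : ℝ} (hx : 0 < x) {w : ℂ}
    (hw : x ≤ w.re) (u : ℝ) :
    ‖(Real.cosh u : ℂ) ^ n * Complex.exp (-w * Real.cosh u)‖
      ≤ m.factorial / x ^ m * 2 * Real.exp (-u) := by
  have hc1 : 1 ≤ Real.cosh u := Real.one_le_cosh u
  have hc : 0 < Real.cosh u := by linarith
  have hinv : (Real.cosh u)⁻¹ ≤ 2 * Real.exp (-u) := by
    rw [inv_le_iff_one_le_mul₀ hc, Real.cosh_eq]
    have h : Real.exp (-u) * Real.exp u = 1 := by rw [← Real.exp_add]; simp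
    nlinarith [Real.exp_pos (-u), Real.exp_pos u]
  have hre : (-w * Real.cosh u).re = -(w.re * Real.cosh u) := by simp
  rw [norm_mul, norm_pow, Complex.norm_exp, hre, Complex.norm_real, Real.norm_of_nonneg hc.le]
  have hexp : Real.exp (-(w.re * Real.cosh u)) ≤ m.factorial / (x * Real.cosh u) ^ m := by
    have hy : 0 < x * Real.cosh u := by positivity
    have h1 := Real.pow_div_factorial_le_exp (x * Real.cosh u) hy.le m
    calc Real.exp (-(w.re * Real.cosh u)) ≤ Real.exp (-(x * Real.cosh u)) := by gcongr
      _ = (Real.exp (x * Real.cosh u))⁻¹ := Real.exp_neg _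
      _ ≤ ((x * Real.cosh u) ^ m / m.factorial)⁻¹ := by gcongr
      _ = _ := inv_div _ _
  calc Real.cosh u ^ n * Real.exp (-(w.re * Real.cosh u))
      ≤ Real.cosh u ^ n * (m.factorial / (x * Real.cosh u) ^ m) := by gcongr
    _ ≤ Real.cosh u ^ (m - 1) * (m.factorial / (x * Real.cosh u) ^ m) := by
        gcongr
        omega
    _ = m.factorial / x ^ m * (Real.cosh u)⁻¹ := by
        obtain ⟨k, rfl⟩ : ∃ k, m = k + 1 := ⟨m - 1, by omega⟩
        rw [Nat.add_sub_cancel, mul_pow, pow_succ (Real.cosh u)]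
        field_simp
    _ ≤ m.factorial / x ^ m * (2 * Real.exp (-u)) := by gcongr
    _ = _ := by ring

theorem integrableOn_cosh_pow_mul_exp (n : ℕ) {w : ℂ} (hw : 0 < w.re) :
    IntegrableOn (fun u : ℝ => (Real.cosh u : ℂ) ^ n * Complex.exp (-w * Real.cosh u))
      (Ioi 0) := by
  refine Integrable.mono' ((integrableOn_exp_neg_Ioi 0).const_mul
    ((n + 1).factorial / w.re ^ (n + 1) * 2)) ?_ ?_
  · exact (by fun_prop : Continuous fun u : ℝ =>
      (Real.cosh u : ℂ) ^ n * Complex.exp (-w * Real.cosh u)).aestronglyMeasurable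
  · exact ae_of_all _ fun u => norm_cosh_pow_mul_exp_le n.lt_succ_self hw le_rfl u

/-- A continuous multiple of a kernel by a bounded function is integrable. -/
theorem IntegrableOn.bounded_mul_cosh_pow_mul_exp {n : ℕ} {w : ℂ} (hw : 0 < w.re) {f : ℝ → ℂ}
    (hf : Continuous f) {M : ℝ} (hM : ∀ u ∈ Ioi (0 : ℝ), ‖f u‖ ≤ M) :
    IntegrableOn (fun u : ℝ => f u * ((Real.cosh u : ℂ) ^ n * Complex.exp (-w * Real.cosh u)))
      (Ioi 0) :=
  (integrableOn_cosh_pow_mul_exp n hw).bdd_mul hf.aestronglyMeasurable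
    ((ae_restrict_iff' measurableSet_Ioi).2 (ae_of_all _ hM))

theorem norm_besselMoment_le {n m : ℕ} (hnm : n < m) {x : ℝ} (hx : 0 < x) {w : ℂ}
    (hw : x ≤ w.re) : ‖besselMoment n w‖ ≤ m.factorial / x ^ m * 2 := by
  have h := norm_integral_le_of_norm_le (μ := volume.restrict (Ioi 0))
    ((integrableOn_exp_neg_Ioi 0).const_mul (m.factorial / x ^ m * 2))
    (ae_of_all _ fun u => norm_cosh_pow_mul_exp_le hnm hx hw u)
  rw [integral_const_mul, integral_exp_neg_Ioi_zero, mul_one] at h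
  exact h

theorem hasDerivAt_besselMoment (n : ℕ) {w : ℂ} (hw : 0 < w.re) :
    HasDerivAt (besselMoment n) (-besselMoment (n + 1) w) w := by
  have hs : {z : ℂ | w.re / 2 < z.re} ∈ 𝓝 w :=
    (isOpen_lt continuous_const Complex.continuous_re).mem_nhds (by simp; linarith)
  have key := hasDerivAt_integral_of_dominated_loc_of_deriv_le
    (μ := volume.restrict (Ioi (0 : ℝ))) (x₀ := w)
    (F := fun z u => (Real.cosh u : ℂ) ^ n * Complex.exp (-z * Real.cosh u))
    (F' := fun z u => -((Real.cosh u : ℂ) ^ (n + 1) * Complex.exp (-z * Real.cosh u)))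
    (bound := fun u => (n + 2).factorial / (w.re / 2) ^ (n + 2) * 2 * Real.exp (-u)) hs
    (Eventually.of_forall fun z => (by fun_prop : Continuous fun u : ℝ =>
      (Real.cosh u : ℂ) ^ n * Complex.exp (-z * Real.cosh u)).aestronglyMeasurable)
    (integrableOn_cosh_pow_mul_exp n hw)
    ((by fun_prop : Continuous fun u : ℝ =>
      -((Real.cosh u : ℂ) ^ (n + 1) * Complex.exp (-w * Real.cosh u))).aestronglyMeasurable)
    (ae_of_all _ fun u z hz => by
      rw [norm_neg]
      exact norm_cosh_pow_mul_exp_le (n + 1).lt_succ_self (half_pos hw) (le_of_lt hz) u)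
    ((integrableOn_exp_neg_Ioi 0).const_mul _)
    (ae_of_all _ fun u z _ => by
      have h1 : HasDerivAt (fun z : ℂ => -z * (Real.cosh u : ℂ)) (-1 * (Real.cosh u : ℂ)) z :=
        (hasDerivAt_id z).neg.mul_const _
      convert! (h1.cexp.const_mul ((Real.cosh u : ℂ) ^ n)) using 1
      ring)
  have h := key.2
  rw [integral_neg] at h
  exact h

theorem tendsto_mul_exp_neg_mul_cosh {w : ℂ} (hw : 0 < w.re) {f : ℝ → ℂ} {M : ℝ} (n : ℕ)
    (hM : ∀ u ∈ Ioi (0 : ℝ), ‖f u‖ ≤ M * Real.cosh u ^ n) :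
    Tendsto (fun u : ℝ => f u * Complex.exp (-w * Real.cosh u)) atTop (𝓝 0) := by
  have h0 : Tendsto (fun u : ℝ => M * ((n + 1).factorial / w.re ^ (n + 1) * 2 * Real.exp (-u)))
      atTop (𝓝 0) := by
    simpa using ((Real.tendsto_exp_neg_atTop_nhds_zero.const_mul
      ((n + 1).factorial / w.re ^ (n + 1) * 2)).const_mul M)
  refine squeeze_zero_norm' ?_ h0
  filter_upwards [eventually_gt_atTop (0 : ℝ)] with u hu
  have hc : 0 < Real.cosh u := Real.cosh_pos u
  have hM0 : 0 ≤ M := by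
    have := (norm_nonneg _).trans (hM u hu)
    exact nonneg_of_mul_nonneg_left this (by positivity)
  have h := norm_cosh_pow_mul_exp_le n.lt_succ_self hw le_rfl u
  rw [norm_mul, norm_pow, Complex.norm_real, Real.norm_of_nonneg hc.le] at h
  calc ‖f u * Complex.exp (-w * Real.cosh u)‖
      = ‖f u‖ * ‖Complex.exp (-w * Real.cosh u)‖ := norm_mul _ _
    _ ≤ M * Real.cosh u ^ n * ‖Complex.exp (-w * Real.cosh u)‖ := by gcongr; exact hM u hu
    _ = M * (Real.cosh u ^ n * ‖Complex.exp (-w * Real.cosh u)‖) := by ring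
    _ ≤ _ := by gcongr

theorem hasDerivAt_exp_neg_mul_cosh (w : ℂ) (u : ℝ) :
    HasDerivAt (fun u : ℝ => Complex.exp (-w * Real.cosh u))
      (Complex.exp (-w * Real.cosh u) * (-w * Real.sinh u)) u := by
  exact (((Real.hasDerivAt_cosh u).ofReal_comp).const_mul (-w)).cexp

/-- The modified Bessel equation in integrated form. -/
theorem besselMoment_one_eq {w : ℂ} (hw : 0 < w.re) :
    besselMoment 1 w - w * besselMoment 2 w = -w * besselMoment 0 w := by
  have i0 := integrableOn_cosh_pow_mul_exp 0 hw
  have i1 := integrableOn_cosh_pow_mul_exp 1 hw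
  have i2 := integrableOn_cosh_pow_mul_exp 2 hw
  have i12 : IntegrableOn (fun u : ℝ =>
      (Real.cosh u : ℂ) ^ 1 * Complex.exp (-w * Real.cosh u)
      - w * ((Real.cosh u : ℂ) ^ 2 * Complex.exp (-w * Real.cosh u))) (Ioi 0) :=
    i1.sub (i2.const_mul w)
  have key := integral_Ioi_of_hasDerivAt_of_tendsto' (a := 0) (m := 0)
    (f := fun u : ℝ => (Real.sinh u : ℂ) * Complex.exp (-w * Real.cosh u))
    (f' := fun u : ℝ => (Real.cosh u : ℂ) ^ 1 * Complex.exp (-w * Real.cosh u)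
      - w * ((Real.cosh u : ℂ) ^ 2 * Complex.exp (-w * Real.cosh u))
      + w * ((Real.cosh u : ℂ) ^ 0 * Complex.exp (-w * Real.cosh u)))
    (fun u _ => by
      convert! ((Real.hasDerivAt_sinh u).ofReal_comp).mul (hasDerivAt_exp_neg_mul_cosh w u) using 1
      have h : (Real.cosh u : ℂ) ^ 2 - (Real.sinh u : ℂ) ^ 2 = 1 := by
        exact_mod_cast Real.cosh_sq_sub_sinh_sq u
      linear_combination (-w * Complex.exp (-w * Real.cosh u)) * h)
    (i12.add (i0.const_mul w))
    (tendsto_mul_exp_neg_mul_cosh (M := 1) hw 1 fun u hu => by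
      rw [Complex.norm_real, Real.norm_of_nonneg (Real.sinh_nonneg_iff.2 (le_of_lt hu))]
      simpa using (Real.sinh_lt_cosh u).le)
  rw [integral_add i12 (i0.const_mul w), integral_sub i1 (i2.const_mul w),
    integral_const_mul, integral_const_mul] at key
  simp only [Real.sinh_zero, Complex.ofReal_zero, zero_mul, sub_zero] at key
  simp only [besselMoment]
  linear_combination key

/-- The integral `∫_0^∞ exp (-w cosh u) exp (-2u) du`. -/
noncomputable def besselTail (w : ℂ) : ℂ :=
  ∫ u in Ioi (0 : ℝ), (Real.exp (-(2 * u)) : ℂ) * Complex.exp (-w * Real.cosh u)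

theorem norm_besselTail_le_one {w : ℂ} (hw : 0 < w.re) : ‖besselTail w‖ ≤ 1 := by
  have h := norm_integral_le_of_norm_le (μ := volume.restrict (Ioi (0 : ℝ)))
    (f := fun u : ℝ => (Real.exp (-(2 * u)) : ℂ) * Complex.exp (-w * Real.cosh u))
    (integrableOn_exp_neg_Ioi 0)
    ((ae_restrict_iff' measurableSet_Ioi).2 (ae_of_all _ fun u (hu : 0 < u) => by
      rw [norm_mul, Complex.norm_exp, Complex.norm_real, Real.norm_of_nonneg (Real.exp_pos _).le,
        ← Real.exp_add]
      refine Real.exp_le_exp.2 ?_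
      have : 0 ≤ w.re * Real.cosh u := by have := Real.cosh_pos u; positivity
      simp only [neg_mul, Complex.neg_re, Complex.re_mul_ofReal]
      linarith))
  rw [integral_exp_neg_Ioi_zero] at h
  exact h

theorem norm_besselTail_le {x : ℝ} (hx : 0 < x) {w : ℂ} (hw : x ≤ w.re) :
    ‖besselTail w‖ ≤ 4 / x ^ 2 := by
  have h := norm_integral_le_of_norm_le (μ := volume.restrict (Ioi (0 : ℝ)))
    (f := fun u : ℝ => (Real.exp (-(2 * u)) : ℂ) * Complex.exp (-w * Real.cosh u))
    ((integrableOn_exp_neg_Ioi 0).const_mul ((2 : ℕ).factorial / x ^ 2 * 2))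
    ((ae_restrict_iff' measurableSet_Ioi).2 (ae_of_all _ fun u (hu : 0 < u) => by
      have h1 := norm_cosh_pow_mul_exp_le (n := 0) (m := 2) (by norm_num) hx hw u
      rw [pow_zero, one_mul] at h1
      rw [norm_mul, Complex.norm_real, Real.norm_of_nonneg (Real.exp_pos _).le]
      refine le_trans (mul_le_of_le_one_left (norm_nonneg _) ?_) h1
      exact Real.exp_le_one_iff.2 (by linarith)))
  rw [integral_const_mul, integral_exp_neg_Ioi_zero] at h
  refine h.trans (le_of_eq ?_)
  norm_num [Nat.factorial]
  ring

/-- The function `w ↦ K_0(w) - 2 (1 - w K_1(w)) / w ^ 2`. -/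
noncomputable def besselRemainder (w : ℂ) : ℂ :=
  besselMoment 0 w - 2 * ((1 - w * besselMoment 1 w) / w ^ 2)

theorem sq_mul_besselRemainder {w : ℂ} (hw : 0 < w.re) :
    w ^ 2 * besselRemainder w
      = w ^ 2 * besselTail w - 2 * (1 - (1 + w) * Complex.exp (-w)) := by
  have hw0 : w ≠ 0 := by rintro rfl; simp at hw
  have i0 := integrableOn_cosh_pow_mul_exp 0 hw
  have i1 := integrableOn_cosh_pow_mul_exp 1 hw
  have it : IntegrableOn (fun u : ℝ => (Real.exp (-(2 * u)) : ℂ)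
      * ((Real.cosh u : ℂ) ^ 0 * Complex.exp (-w * Real.cosh u))) (Ioi 0) :=
    IntegrableOn.bounded_mul_cosh_pow_mul_exp (M := 1) hw (by fun_prop) fun u hu => by
      rw [Complex.norm_real, Real.norm_of_nonneg (Real.exp_pos _).le]
      exact Real.exp_le_one_iff.2 (by have : (0 : ℝ) < u := hu; linarith)
  have i0t : IntegrableOn (fun u : ℝ =>
      w ^ 2 / 2 * ((Real.cosh u : ℂ) ^ 0 * Complex.exp (-w * Real.cosh u))
      - w ^ 2 / 2 * ((Real.exp (-(2 * u)) : ℂ)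
        * ((Real.cosh u : ℂ) ^ 0 * Complex.exp (-w * Real.cosh u)))) (Ioi 0) :=
    (i0.const_mul _).sub (it.const_mul _)
  have key := integral_Ioi_of_hasDerivAt_of_tendsto' (a := 0) (m := 0)
    (f := fun u : ℝ => -(w * (Real.exp (-u) : ℂ) + 1) * Complex.exp (-w * Real.cosh u))
    (f' := fun u : ℝ => w ^ 2 / 2 * ((Real.cosh u : ℂ) ^ 0 * Complex.exp (-w * Real.cosh u))
      - w ^ 2 / 2 * ((Real.exp (-(2 * u)) : ℂ)
        * ((Real.cosh u : ℂ) ^ 0 * Complex.exp (-w * Real.cosh u)))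
      + w * ((Real.cosh u : ℂ) ^ 1 * Complex.exp (-w * Real.cosh u)))
    (fun u _ => by
      have h1 : HasDerivAt (fun u : ℝ => (Real.exp (-u) : ℂ))
          ((Real.exp (-u) * (-1) : ℝ) : ℂ) u := ((hasDerivAt_neg u).exp).ofReal_comp
      convert! (((h1.const_mul w).add_const 1).neg).mul (hasDerivAt_exp_neg_mul_cosh w u) using 1
      have e2 : (Real.exp (-(2 * u)) : ℂ) = (Real.exp (-u) : ℂ) ^ 2 := by
        rw [← Complex.ofReal_pow, ← Real.exp_nat_mul]
        congr 2
        push_cast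
        ring
      have e1 : (Real.exp u : ℂ) * (Real.exp (-u) : ℂ) = 1 := by
        rw [← Complex.ofReal_mul, ← Real.exp_add]; simp
      have ec : (Real.cosh u : ℂ) = ((Real.exp u : ℂ) + (Real.exp (-u) : ℂ)) / 2 := by
        rw [Real.cosh_eq]; push_cast; rfl
      have es : (Real.sinh u : ℂ) = ((Real.exp u : ℂ) - (Real.exp (-u) : ℂ)) / 2 := by
        rw [Real.sinh_eq]; push_cast; rfl
      generalize Complex.exp (-w * Real.cosh u) = E
      simp only [Pi.neg_apply]
      rw [e2, es, ec]
      push_cast at e1 ⊢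
      linear_combination (-w ^ 2 / 2 * E) * e1)
    (i0t.add (i1.const_mul w))
    (tendsto_mul_exp_neg_mul_cosh (M := ‖w‖ + 1) hw 0 fun u hu => by
      rw [norm_neg, pow_zero, mul_one]
      refine (norm_add_le _ _).trans ?_
      rw [norm_mul, Complex.norm_real, Real.norm_of_nonneg (Real.exp_pos _).le, norm_one]
      gcongr
      refine mul_le_of_le_one_right (norm_nonneg _) (Real.exp_le_one_iff.2 ?_)
      have : (0 : ℝ) < u := hu
      linarith)
  rw [integral_add i0t (i1.const_mul w),
    integral_sub (i0.const_mul _) (it.const_mul _), integral_const_mul, integral_const_mul,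
    integral_const_mul] at key
  simp only [Real.cosh_zero, neg_zero, Real.exp_zero, Complex.ofReal_one, mul_one, pow_zero,
    one_mul] at key
  have hr : w ^ 2 * besselRemainder w
      = w ^ 2 * besselMoment 0 w - 2 * (1 - w * besselMoment 1 w) := by
    rw [besselRemainder]; field_simp
  rw [hr]
  simp only [besselMoment, besselTail, pow_zero, one_mul]
  linear_combination 2 * key

theorem norm_one_sub_mul_exp_neg_le {w : ℂ} (hw : 0 < w.re) :
    ‖1 - (1 + w) * Complex.exp (-w)‖ ≤ ‖w‖ ^ 2 := by
  have key : ∫ t in (0 : ℝ)..1, w ^ 2 * (t : ℂ) * Complex.exp (-w * t)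
      = -(1 + w * (1 : ℝ)) * Complex.exp (-w * (1 : ℝ))
        - -(1 + w * (0 : ℝ)) * Complex.exp (-w * (0 : ℝ)) := by
    refine intervalIntegral.integral_eq_sub_of_hasDerivAt
      (f := fun t : ℝ => -(1 + w * (t : ℂ)) * Complex.exp (-w * t)) (fun t _ => ?_)
      (Continuous.intervalIntegrable (by fun_prop) _ _)
    have h1 : HasDerivAt (fun t : ℝ => (t : ℂ)) 1 t := Complex.ofRealCLM.hasDerivAt
    convert! ((h1.const_mul w).const_add 1).neg.mul ((h1.const_mul (-w)).cexp) using 1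
    simp only [Pi.neg_apply]
    ring
  have hn := intervalIntegral.norm_integral_le_of_norm_le_const (a := 0) (b := 1) (C := ‖w‖ ^ 2)
    (f := fun t : ℝ => w ^ 2 * (t : ℂ) * Complex.exp (-w * t)) (fun t ht => by
      rw [uIoc_of_le zero_le_one] at ht
      rw [norm_mul, norm_mul, norm_pow, Complex.norm_real, Real.norm_of_nonneg ht.1.le,
        Complex.norm_exp]
      have h1 : Real.exp ((-w * (t : ℂ)).re) ≤ 1 := by
        refine Real.exp_le_one_iff.2 ?_
        have := mul_pos hw ht.1
        simp only [neg_mul, Complex.neg_re, Complex.re_mul_ofReal]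
        linarith
      have h2 : t * Real.exp ((-w * (t : ℂ)).re) ≤ 1 :=
        mul_le_one₀ ht.2 (Real.exp_pos _).le h1
      rw [mul_assoc]
      exact mul_le_of_le_one_right (by positivity) h2)
  rw [key] at hn
  have e : -(1 + w * ((1 : ℝ) : ℂ)) * Complex.exp (-w * ((1 : ℝ) : ℂ))
        - -(1 + w * ((0 : ℝ) : ℂ)) * Complex.exp (-w * ((0 : ℝ) : ℂ))
      = 1 - (1 + w) * Complex.exp (-w) := by
    simp; ring
  rw [e] at hn
  simpa using hn

theorem exists_norm_besselRemainder_le {c : ℝ} (hc : 0 < c) :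
    ∃ C : ℝ, 0 < C ∧ ∀ w : ℂ, 0 < w.re → c * ‖w‖ ≤ w.re →
      ‖besselRemainder w‖ ≤ C / (1 + ‖w‖ ^ 2) := by
  refine ⟨7 + 4 / c ^ 2 + 2 / c, by positivity, fun w hw hcw => ?_⟩
  have hw0 : w ≠ 0 := by rintro rfl; simp at hw
  have hN : 0 < ‖w‖ := norm_pos_iff.2 hw0
  have hx : 0 < c * ‖w‖ := by positivity
  have key := congrArg norm (sq_mul_besselRemainder hw)
  rw [norm_mul, norm_pow] at key
  have hsub := norm_sub_le (w ^ 2 * besselTail w) (2 * (1 - (1 + w) * Complex.exp (-w)))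
  rw [← key, norm_mul, norm_mul, norm_pow, RCLike.norm_ofNat] at hsub
  have ht1 := norm_besselTail_le_one hw
  have ht2 : ‖w‖ ^ 2 * ‖besselTail w‖ ≤ 4 / c ^ 2 := by
    have h := mul_le_mul_of_nonneg_left (norm_besselTail_le hx hcw) (sq_nonneg ‖w‖)
    refine h.trans (le_of_eq ?_)
    field_simp
  have he1 := norm_one_sub_mul_exp_neg_le hw
  have he2 : ‖1 - (1 + w) * Complex.exp (-w)‖ ≤ 2 + 1 / c := by
    have hexp : Real.exp (-w.re) ≤ 1 := Real.exp_le_one_iff.2 (by linarith)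
    have hexp' : ‖w‖ * Real.exp (-w.re) ≤ 1 / c := by
      have h1 : Real.exp (-w.re) ≤ Real.exp (-(c * ‖w‖)) := Real.exp_le_exp.2 (by linarith)
      have h2 : c * ‖w‖ * Real.exp (-(c * ‖w‖)) ≤ 1 := by
        rw [Real.exp_neg, ← div_eq_mul_inv, div_le_one (Real.exp_pos _)]
        linarith [Real.add_one_le_exp (c * ‖w‖)]
      rw [le_div_iff₀ hc]
      nlinarith [mul_le_mul_of_nonneg_left h1 hx.le]
    calc ‖1 - (1 + w) * Complex.exp (-w)‖
        ≤ ‖(1 : ℂ)‖ + ‖(1 + w) * Complex.exp (-w)‖ := norm_sub_le _ _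
      _ ≤ 1 + (1 + ‖w‖) * Real.exp (-w.re) := by
          rw [norm_one, norm_mul, Complex.norm_exp, Complex.neg_re]
          gcongr
          exact (norm_add_le _ _).trans (by rw [norm_one])
      _ ≤ 2 + 1 / c := by linarith
  have hb1 : ‖besselRemainder w‖ ≤ 3 := by
    have h : ‖w‖ ^ 2 * ‖besselRemainder w‖ ≤ ‖w‖ ^ 2 * 3 := by
      nlinarith [mul_le_mul_of_nonneg_left ht1 (sq_nonneg ‖w‖)]
    exact le_of_mul_le_mul_left h (by positivity)
  rw [le_div_iff₀ (by positivity)]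
  have : 2 * (1 / c) = 2 / c := by ring
  nlinarith

theorem sq_mul_norm_besselMoment_zero_le {c : ℝ} (hc : 0 < c) {w : ℂ} (hw : 0 < w.re)
    (hcw : c * ‖w‖ ≤ w.re) : ‖w‖ ^ 2 * ‖besselMoment 0 w‖ ≤ 4 / c ^ 2 := by
  have hw0 : w ≠ 0 := by rintro rfl; simp at hw
  have hN : 0 < ‖w‖ := norm_pos_iff.2 hw0
  have h := mul_le_mul_of_nonneg_left
    (norm_besselMoment_le (n := 0) (m := 2) (by norm_num) (by positivity) hcw) (sq_nonneg ‖w‖)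
  refine h.trans (le_of_eq ?_)
  norm_num [Nat.factorial]
  field_simp
  norm_num

theorem exists_norm_mul_besselMoment_one_le {c : ℝ} (hc : 0 < c) :
    ∃ C : ℝ, 0 < C ∧ ∀ w : ℂ, 0 < w.re → c * ‖w‖ ≤ w.re → ‖w * besselMoment 1 w‖ ≤ C := by
  obtain ⟨C, hC, hb⟩ := exists_norm_besselRemainder_le hc
  refine ⟨1 + (4 / c ^ 2 + C), by positivity, fun w hw hcw => ?_⟩
  have hw0 : w ≠ 0 := by rintro rfl; simp at hw
  have e : w * besselMoment 1 w
      = 1 - (w ^ 2 * besselMoment 0 w - w ^ 2 * besselRemainder w) / 2 := by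
    rw [besselRemainder]; field_simp; ring
  have h0 := sq_mul_norm_besselMoment_zero_le hc hw hcw
  have h1 : ‖w‖ ^ 2 * ‖besselRemainder w‖ ≤ C := by
    have := hb w hw hcw
    rw [le_div_iff₀ (by positivity)] at this
    nlinarith [norm_nonneg (besselRemainder w)]
  rw [e]
  refine (norm_sub_le _ _).trans ?_
  rw [norm_one, norm_div, RCLike.norm_ofNat]
  have h2 := norm_sub_le (w ^ 2 * besselMoment 0 w) (w ^ 2 * besselRemainder w)
  rw [norm_mul, norm_mul, norm_pow] at h2
  linarith [norm_nonneg (w ^ 2 * besselMoment 0 w - w ^ 2 * besselRemainder w)]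

/-- Points `κ r` with `r` near `1` stay in a sector around the positive axis. -/
theorem le_re_mul_of_mem_ball {c : ℝ} (hc : 0 < c) (hc1 : c ≤ 1) {κ r : ℂ} (hκ : 0 < κ.re)
    (hcκ : c * ‖κ‖ ≤ κ.re) (hr : r ∈ ball (1 : ℂ) (c / 2)) :
    ‖κ‖ / 2 ≤ ‖κ * r‖ ∧ 0 < (κ * r).re ∧ c / 4 * ‖κ * r‖ ≤ (κ * r).re := by
  have hN : 0 < ‖κ‖ := norm_pos_iff.2 (by rintro rfl; simp at hκ)
  rw [mem_ball, dist_eq_norm] at hr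
  have e : κ * r = κ + κ * (r - 1) := by ring
  have h1 : |(κ * (r - 1)).re| ≤ ‖κ‖ * (c / 2) :=
    (Complex.abs_re_le_norm _).trans (by rw [norm_mul]; gcongr)
  have h2 : c / 2 * ‖κ‖ ≤ (κ * r).re := by
    rw [e, Complex.add_re]
    have := (abs_le.1 h1).1
    nlinarith
  have hr1 : ‖r‖ ≤ 2 := by
    have := norm_add_le (r - 1) 1
    rw [sub_add_cancel, norm_one] at this
    linarith
  have hr2 : 1 / 2 ≤ ‖r‖ := by
    have := norm_sub_norm_le (1 : ℂ) (1 - r)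
    rw [sub_sub_cancel, norm_one, norm_sub_rev] at this
    linarith
  rw [norm_mul]
  refine ⟨by nlinarith, lt_of_lt_of_le (by positivity) h2, le_trans ?_ h2⟩
  have : ‖κ‖ * ‖r‖ ≤ ‖κ‖ * 2 := by gcongr
  nlinarith

theorem differentiableOn_besselMoment_mul {c : ℝ} (hc : 0 < c) (hc1 : c ≤ 1) {κ : ℂ}
    (hκ : 0 < κ.re) (hcκ : c * ‖κ‖ ≤ κ.re) (n : ℕ) :
    DifferentiableOn ℂ (fun r => besselMoment n (κ * r)) (ball 1 (c / 2)) := fun r hr =>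
  (HasDerivAt.comp r (hasDerivAt_besselMoment n (le_re_mul_of_mem_ball hc hc1 hκ hcκ hr).2.1)
    ((hasDerivAt_id r).const_mul κ)).differentiableAt.differentiableWithinAt

theorem differentiableAt_besselRemainder {w : ℂ} (hw : 0 < w.re) :
    DifferentiableAt ℂ besselRemainder w := by
  have hw0 : w ≠ 0 := by rintro rfl; simp at hw
  have h0 := (hasDerivAt_besselMoment 0 hw).differentiableAt
  have h1 := (hasDerivAt_besselMoment 1 hw).differentiableAt
  exact h0.sub ((((differentiableAt_const _).sub (differentiableAt_id.mul h1)).div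
    (differentiableAt_id.pow 2) (pow_ne_zero 2 hw0)).const_mul 2)

theorem differentiableOn_besselRemainder_mul {c : ℝ} (hc : 0 < c) (hc1 : c ≤ 1) {κ : ℂ}
    (hκ : 0 < κ.re) (hcκ : c * ‖κ‖ ≤ κ.re) :
    DifferentiableOn ℂ (fun r => besselRemainder (κ * r)) (ball 1 (c / 2)) := fun r hr =>
  (DifferentiableAt.comp r
    (differentiableAt_besselRemainder (le_re_mul_of_mem_ball hc hc1 hκ hcκ hr).2.1)
    (differentiableAt_id.const_mul κ)).differentiableWithinAt

theorem exists_norm_bessel_mul_le {c : ℝ} (hc : 0 < c) (hc1 : c ≤ 1) :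
    ∃ C : ℝ, 0 < C ∧ ∀ κ : ℂ, 0 < κ.re → c * ‖κ‖ ≤ κ.re → ∀ r ∈ ball (1 : ℂ) (c / 2),
      ‖besselRemainder (κ * r)‖ ≤ C / (1 + ‖κ‖ ^ 2) ∧
      ‖besselMoment 0 (κ * r) - besselMoment 0 κ‖ ≤ C / (1 + ‖κ‖ ^ 2) := by
  have hc4 : 0 < c / 4 := by positivity
  obtain ⟨B, hB, hb⟩ := exists_norm_besselRemainder_le hc4
  obtain ⟨D, hD, hd⟩ := exists_norm_mul_besselMoment_one_le hc4
  refine ⟨4 * B + (2 * D + 8 * (4 / (c / 4) ^ 2)), by positivity, fun κ hκ hcκ r hr => ⟨?_, ?_⟩⟩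
  · obtain ⟨h1, h2, h3⟩ := le_re_mul_of_mem_ball hc hc1 hκ hcκ hr
    refine (hb _ h2 h3).trans ?_
    rw [div_le_div_iff₀ (by positivity) (by positivity)]
    have h4 : (‖κ‖ / 2) ^ 2 ≤ ‖κ * r‖ ^ 2 := by gcongr
    have h5 : 0 ≤ (2 * D + 8 * (4 / (c / 4) ^ 2)) := by positivity
    have h6 : B * (1 + ‖κ‖ ^ 2) ≤ 4 * B * (1 + ‖κ * r‖ ^ 2) := by nlinarith
    refine h6.trans ?_
    gcongr
    linarith
  · have hs1 : (1 : ℂ) ∈ ball (1 : ℂ) (c / 2) := mem_ball_self (by positivity)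
    have hdiff : ‖besselMoment 0 (κ * r) - besselMoment 0 (κ * 1)‖ ≤ 2 * D * ‖r - 1‖ := by
      refine (convex_ball (1 : ℂ) (c / 2)).norm_image_sub_le_of_norm_hasDerivWithin_le
        (f := fun r => besselMoment 0 (κ * r)) (f' := fun r => -besselMoment 1 (κ * r) * κ)
        (fun s hs => ?_) (fun s hs => ?_) hs1 hr
      · have h := HasDerivAt.comp s
          (hasDerivAt_besselMoment 0 (le_re_mul_of_mem_ball hc hc1 hκ hcκ hs).2.1)
          ((hasDerivAt_id s).const_mul κ)
        rw [mul_one] at h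
        exact h.hasDerivWithinAt
      · obtain ⟨h1, h2, h3⟩ := le_re_mul_of_mem_ball hc hc1 hκ hcκ hs
        have h4 := hd _ h2 h3
        rw [norm_mul] at h4
        rw [norm_mul, norm_neg]
        nlinarith [norm_nonneg (besselMoment 1 (κ * s))]
    rw [mul_one] at hdiff
    have hr1 : ‖r - 1‖ ≤ 1 := by
      rw [mem_ball, dist_eq_norm] at hr
      linarith
    have hdiff' : ‖besselMoment 0 (κ * r) - besselMoment 0 κ‖ ≤ 2 * D :=
      hdiff.trans (mul_le_of_le_one_right (by positivity) hr1)
    have key : ∀ s ∈ ball (1 : ℂ) (c / 2),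
        ‖κ‖ ^ 2 * ‖besselMoment 0 (κ * s)‖ ≤ 4 * (4 / (c / 4) ^ 2) := fun s hs => by
      obtain ⟨h1, h2, h3⟩ := le_re_mul_of_mem_ball hc hc1 hκ hcκ hs
      have h4 := sq_mul_norm_besselMoment_zero_le hc4 h2 h3
      have h5 : (‖κ‖ / 2) ^ 2 ≤ ‖κ * s‖ ^ 2 := by gcongr
      nlinarith [norm_nonneg (besselMoment 0 (κ * s))]
    have k1 := key r hr
    have k2 := key 1 hs1
    rw [mul_one] at k2
    have k3 := mul_le_mul_of_nonneg_left
      (norm_sub_le (besselMoment 0 (κ * r)) (besselMoment 0 κ)) (sq_nonneg ‖κ‖)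
    rw [le_div_iff₀ (by positivity)]
    nlinarith

theorem iteratedDeriv_comp_ofReal_of_differentiableOn {g : ℂ → ℂ} {U : Set ℂ} (hU : IsOpen U)
    (hg : DifferentiableOn ℂ g U) (n : ℕ) {r : ℝ} (hr : (r : ℂ) ∈ U) :
    iteratedDeriv n (fun r : ℝ => g r) r = iteratedDeriv n g r := by
  induction n generalizing r with
  | zero => simp
  | succ n ih =>
    rw [iteratedDeriv_succ, iteratedDeriv_succ]
    have hV : {s : ℝ | (s : ℂ) ∈ U} ∈ 𝓝 r :=
      (hU.preimage Complex.continuous_ofReal).mem_nhds hr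
    have he : iteratedDeriv n (fun r : ℝ => g r) =ᶠ[𝓝 r] fun s : ℝ => iteratedDeriv n g s := by
      filter_upwards [hV] with s hs using ih hs
    rw [he.deriv_eq]
    have : DifferentiableAt ℂ (iteratedDeriv n g) r := by
      rw [iteratedDeriv_eq_iterate]
      exact ((hg.analyticOnNhd hU).iterated_deriv n _ hr).differentiableAt
    exact this.hasDerivAt.comp_ofReal.deriv

theorem exists_norm_iteratedFDeriv_le_on_sphere {F : Type*} [NormedAddCommGroup F]
    [NormedSpace ℝ F] {σ : Plane → F} (hσ : ContDiffOn ℝ ∞ σ {0}ᶜ) (ℓ : ℕ) :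
    ∃ S : ℝ, 0 ≤ S ∧ ∀ i ≤ ℓ, ∀ x : Plane, ‖x‖ = 1 → ‖iteratedFDeriv ℝ i σ x‖ ≤ S := by
  have h : ∀ i : ℕ, ∃ S : ℝ, 0 ≤ S ∧ ∀ x : Plane, ‖x‖ = 1 → ‖iteratedFDeriv ℝ i σ x‖ ≤ S := by
    intro i
    have hc : ContinuousOn (iteratedFDeriv ℝ i σ) (sphere (0 : Plane) 1) :=
      (ContinuousOn.continuousOn_iteratedFDeriv hσ isOpen_compl_singleton
        (by exact_mod_cast le_top)).mono fun x hx h0 => by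
          rw [mem_singleton_iff] at h0
          simp [h0] at hx
    obtain ⟨S, hS⟩ := (isCompact_sphere (0 : Plane) 1).exists_bound_of_continuousOn hc
    exact ⟨max S 0, le_max_right _ _, fun x hx =>
      (hS x (by simpa using hx)).trans (le_max_left _ _)⟩
  choose S hS0 hS using h
  refine ⟨∑ i ∈ Finset.range (ℓ + 1), S i, Finset.sum_nonneg fun i _ => hS0 i,
    fun i hi x hx => (hS i x hx).trans ?_⟩
  exact Finset.single_le_sum (f := S) (fun i _ => hS0 i) (Finset.mem_range.2 (by omega))

theorem contDiffOn_norm_compl_zero : ContDiffOn ℝ ∞ (fun y : Plane => ‖y‖) {0}ᶜ :=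
  fun _ hx => (contDiffAt_norm ℝ hx).contDiffWithinAt

/-- The open annulus on which `‖y‖` lies within `δ` of `1`. -/
def annulus (δ : ℝ) : Set Plane := {y | y ≠ 0 ∧ ‖y‖ ∈ Ioo (1 - δ) (1 + δ)}

theorem isOpen_annulus (δ : ℝ) : IsOpen (annulus δ) :=
  (isOpen_compl_singleton (x := (0 : Plane))).inter (isOpen_Ioo.preimage continuous_norm)

theorem mem_annulus {δ : ℝ} (hδ : 0 < δ) {x : Plane} (hx : ‖x‖ = 1) : x ∈ annulus δ := by
  refine ⟨by rintro rfl; simp at hx, ?_⟩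
  rw [hx]
  constructor <;> linarith

theorem ofReal_mem_ball_of_mem_Ioo {δ r : ℝ} (hr : r ∈ Ioo (1 - δ) (1 + δ)) :
    (r : ℂ) ∈ ball (1 : ℂ) δ := by
  rw [mem_ball, dist_eq_norm, ← Complex.ofReal_one, ← Complex.ofReal_sub, Complex.norm_real,
    Real.norm_eq_abs, abs_lt]
  constructor <;> linarith [hr.1, hr.2]

theorem contDiffOn_comp_ofReal {g : ℂ → ℂ} {U : Set ℂ} (hU : IsOpen U)
    (hg : DifferentiableOn ℂ g U) :
    ContDiffOn ℝ ∞ (fun r : ℝ => g r) {r | (r : ℂ) ∈ U} :=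
  ((hg.contDiffOn hU).restrict_scalars ℝ).comp Complex.ofRealCLM.contDiff.contDiffOn
    fun _ h => h

/-- Cauchy's estimates for a radial function that extends holomorphically to a neighbourhood
of `r = 1`, multiplied by a fixed smooth function. -/
theorem exists_norm_iteratedFDeriv_mul_radial_le {δ : ℝ} (hδ : 0 < δ) (hδ1 : δ ≤ 1)
    {σ : Plane → ℂ} (hσ : ContDiffOn ℝ ∞ σ {0}ᶜ) (ℓ : ℕ) :
    ∃ C : ℝ, 0 ≤ C ∧ ∀ (g : ℂ → ℂ) (M : ℝ), DifferentiableOn ℂ g (ball 1 δ) →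
      (∀ r ∈ ball (1 : ℂ) δ, ‖g r‖ ≤ M) → ∀ x : Plane, ‖x‖ = 1 →
        ContDiffAt ℝ ℓ (fun y => σ y * g (‖y‖ : ℝ)) x ∧
        ‖iteratedFDeriv ℝ ℓ (fun y => σ y * g (‖y‖ : ℝ)) x‖ ≤ C * M := by
  obtain ⟨S, hS0, hS⟩ := exists_norm_iteratedFDeriv_le_on_sphere hσ ℓ
  obtain ⟨D, hD0, hD⟩ := exists_norm_iteratedFDeriv_le_on_sphere contDiffOn_norm_compl_zero ℓ
  set Q : ℝ := ℓ.factorial / (δ / 2) ^ ℓ with hQ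
  have hQ0 : 0 ≤ Q := by positivity
  refine ⟨∑ i ∈ Finset.range (ℓ + 1),
    (ℓ.choose i : ℝ) * S * (ℓ.factorial * Q * (1 + D) ^ ℓ), ?_, ?_⟩
  · exact Finset.sum_nonneg fun i _ => by positivity
  intro g M hg hM x hx
  have hM0 : 0 ≤ M := (norm_nonneg _).trans (hM 1 (mem_ball_self hδ))
  have hxA := mem_annulus hδ hx
  have hAo := isOpen_annulus δ
  have hσA : ContDiffOn ℝ ∞ σ (annulus δ) := hσ.mono fun y hy => hy.1
  have hnA : ContDiffOn ℝ ∞ (fun y : Plane => ‖y‖) (annulus δ) :=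
    contDiffOn_norm_compl_zero.mono fun y hy => hy.1
  have hgI : ContDiffOn ℝ ∞ (fun r : ℝ => g r) (Ioo (1 - δ) (1 + δ)) :=
    (contDiffOn_comp_ofReal isOpen_ball hg).mono fun r hr => ofReal_mem_ball_of_mem_Ioo hr
  have hmaps : MapsTo (fun y : Plane => ‖y‖) (annulus δ) (Ioo (1 - δ) (1 + δ)) :=
    fun y hy => hy.2
  have hgA : ContDiffOn ℝ ∞ (fun y : Plane => g (‖y‖ : ℝ)) (annulus δ) := hgI.comp hnA hmaps
  have hcauchy : ∀ i ≤ ℓ, ‖iteratedFDerivWithin ℝ i (fun r : ℝ => g r) (Ioo (1 - δ) (1 + δ)) ‖x‖‖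
      ≤ Q * M := by
    intro i hi
    have hmem : ‖x‖ ∈ Ioo (1 - δ) (1 + δ) := hxA.2
    rw [iteratedFDerivWithin_of_isOpen i isOpen_Ioo hmem,
      norm_iteratedFDeriv_eq_norm_iteratedDeriv,
      iteratedDeriv_comp_ofReal_of_differentiableOn isOpen_ball hg i
        (ofReal_mem_ball_of_mem_Ioo hmem), hx, Complex.ofReal_one]
    have hsub : closedBall (1 : ℂ) (δ / 2) ⊆ ball 1 δ := closedBall_subset_ball (by linarith)
    have h := Complex.norm_iteratedDeriv_le_of_forall_mem_sphere_norm_le i (half_pos hδ)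
      (DifferentiableOn.diffContOnCl (by
        rw [closure_ball _ (half_pos hδ).ne']; exact hg.mono hsub))
      (fun z hz => hM z (hsub (sphere_subset_closedBall hz)))
    refine h.trans ?_
    have h1 : (i.factorial : ℝ) ≤ ℓ.factorial := by exact_mod_cast Nat.factorial_le hi
    have h2 : (δ / 2) ^ ℓ ≤ (δ / 2) ^ i :=
      pow_le_pow_of_le_one (by positivity) (by linarith) hi
    calc i.factorial * M / (δ / 2) ^ i ≤ ℓ.factorial * M / (δ / 2) ^ ℓ := by gcongr
      _ = Q * M := by rw [hQ]; ring
  have hrad : ∀ i ≤ ℓ, ‖iteratedFDerivWithin ℝ i (fun y : Plane => g (‖y‖ : ℝ)) (annulus δ) x‖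
      ≤ ℓ.factorial * Q * (1 + D) ^ ℓ * M := by
    intro i hi
    have h := norm_iteratedFDerivWithin_comp_le (n := i) hgI hnA (by exact_mod_cast le_top)
      isOpen_Ioo.uniqueDiffOn hAo.uniqueDiffOn hmaps hxA (C := Q * M) (D := 1 + D)
      (fun j hj => hcauchy j (hj.trans hi)) (fun j hj1 hj => by
        rw [iteratedFDerivWithin_of_isOpen j hAo hxA]
        refine (hD j (hj.trans hi) x hx).trans ?_
        exact (by linarith : D ≤ 1 + D).trans (le_self_pow₀ (by linarith) (by omega)))
    refine h.trans ?_
    have h1 : (i.factorial : ℝ) ≤ ℓ.factorial := by exact_mod_cast Nat.factorial_le hi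
    have h2 : (1 + D) ^ i ≤ (1 + D) ^ ℓ := pow_le_pow_right₀ (by linarith) hi
    calc (i.factorial : ℝ) * (Q * M) * (1 + D) ^ i
        ≤ ℓ.factorial * (Q * M) * (1 + D) ^ ℓ := by gcongr
      _ = _ := by ring
  refine ⟨((hσA.mul hgA).contDiffAt (hAo.mem_nhds hxA)).of_le (by exact_mod_cast le_top), ?_⟩
  rw [← iteratedFDerivWithin_of_isOpen ℓ hAo hxA]
  refine (norm_iteratedFDerivWithin_mul_le hσA hgA hAo.uniqueDiffOn hxA
    (by exact_mod_cast le_top)).trans ?_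
  rw [Finset.sum_mul]
  refine Finset.sum_le_sum fun i hi => ?_
  rw [Finset.mem_range] at hi
  have h1 : ‖iteratedFDerivWithin ℝ i σ (annulus δ) x‖ ≤ S := by
    rw [iteratedFDerivWithin_of_isOpen i hAo hxA]
    exact hS i (by omega) x hx
  have h2 := hrad (ℓ - i) (by omega)
  calc _ ≤ (ℓ.choose i : ℝ) * S * (ℓ.factorial * Q * (1 + D) ^ ℓ * M) := by gcongr
    _ = _ := by ring

/-- The value of the velocity fundamental solution, expressed through modified Bessel functions
of `κ ‖y‖`, where `κ ^ 2 = lam`. -/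
noncomputable def stokesProfile (κ : ℂ) (α β : Fin 2) (y : Plane) : ℂ :=
  1 / (2 * Real.pi) * ((if α = β then 1 else 0)
      * ((besselMoment 0 (κ * (‖y‖ : ℝ)) + besselRemainder (κ * (‖y‖ : ℝ))) / 2)
    - ((y α * y β / ‖y‖ ^ 2 : ℝ) : ℂ) * besselRemainder (κ * (‖y‖ : ℝ)))

theorem contDiffOn_coord_mul_div (α β : Fin 2) :
    ContDiffOn ℝ ∞ (fun y : Plane => ((y α * y β / ‖y‖ ^ 2 : ℝ) : ℂ)) {0}ᶜ := by
  have hc : ∀ γ : Fin 2, ContDiff ℝ ∞ fun y : Plane => y γ := fun γ =>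
    (EuclideanSpace.proj (𝕜 := ℝ) γ).contDiff
  refine Complex.ofRealCLM.contDiff.comp_contDiffOn
    (((hc α).mul (hc β)).contDiffOn.div (contDiff_norm_sq ℝ).contDiffOn fun y hy => ?_)
  exact pow_ne_zero 2 (norm_ne_zero_iff.2 hy)

theorem contDiffOn_stokesProfile {κ : ℂ} (hκ : 0 < κ.re) (α β : Fin 2) :
    ContDiffOn ℝ ∞ (stokesProfile κ α β) {0}ᶜ := by
  have hU : IsOpen {z : ℂ | 0 < (κ * z).re} :=
    isOpen_lt continuous_const (Complex.continuous_re.comp (continuous_const_mul κ))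
  have hmaps : MapsTo (fun y : Plane => ‖y‖) {0}ᶜ {r : ℝ | (r : ℂ) ∈ {z : ℂ | 0 < (κ * z).re}} :=
    fun y hy => by
      have : 0 < ‖y‖ := norm_pos_iff.2 hy
      simp only [mem_ofPred_eq, Complex.re_mul_ofReal]
      positivity
  have h0 : ContDiffOn ℝ ∞ (fun y : Plane => besselMoment 0 (κ * (‖y‖ : ℝ))) {0}ᶜ :=
    (contDiffOn_comp_ofReal (g := fun z => besselMoment 0 (κ * z)) hU fun z hz =>
      (DifferentiableAt.comp z (hasDerivAt_besselMoment 0 hz).differentiableAt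
        (differentiableAt_id.const_mul κ)).differentiableWithinAt).comp
      contDiffOn_norm_compl_zero hmaps
  have h1 : ContDiffOn ℝ ∞ (fun y : Plane => besselRemainder (κ * (‖y‖ : ℝ))) {0}ᶜ :=
    (contDiffOn_comp_ofReal (g := fun z => besselRemainder (κ * z)) hU fun z hz =>
      (DifferentiableAt.comp z (differentiableAt_besselRemainder hz)
        (differentiableAt_id.const_mul κ)).differentiableWithinAt).comp
      contDiffOn_norm_compl_zero hmaps
  exact contDiffOn_const.mul ((contDiffOn_const.mul ((h0.add h1).div_const 2)).sub
    ((contDiffOn_coord_mul_div α β).mul h1))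

theorem exists_norm_iteratedFDeriv_stokesProfile_le_on_sphere {c : ℝ} (hc : 0 < c) (hc1 : c ≤ 1)
    {ℓ : ℕ} (hℓ : ℓ ≠ 0) (α β : Fin 2) :
    ∃ C : ℝ, 0 < C ∧ ∀ κ : ℂ, 0 < κ.re → c * ‖κ‖ ≤ κ.re → ∀ x : Plane, ‖x‖ = 1 →
      ‖iteratedFDeriv ℝ ℓ (stokesProfile κ α β) x‖ ≤ C / (1 + ‖κ‖ ^ 2) := by
  obtain ⟨B, hB, hb⟩ := exists_norm_bessel_mul_le hc hc1
  set d : ℂ := 1 / (4 * Real.pi) * (if α = β then 1 else 0) with hd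
  obtain ⟨C₁, hC₁, h₁⟩ := exists_norm_iteratedFDeriv_mul_radial_le (half_pos hc) (by linarith)
    (contDiffOn_const (c := d)) ℓ
  obtain ⟨C₂, hC₂, h₂⟩ := exists_norm_iteratedFDeriv_mul_radial_le (half_pos hc) (by linarith)
    ((contDiffOn_const (c := -(1 / (2 * Real.pi) : ℂ))).mul (contDiffOn_coord_mul_div α β)) ℓ
  refine ⟨C₁ * (2 * B) + C₂ * B + 1, by positivity, fun κ hκ hcκ x hx => ?_⟩
  obtain ⟨s₁, b₁⟩ := h₁
    (fun r => besselMoment 0 (κ * r) - besselMoment 0 κ + besselRemainder (κ * r))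
    (2 * B / (1 + ‖κ‖ ^ 2))
    (((differentiableOn_besselMoment_mul hc hc1 hκ hcκ 0).sub_const _).add
      (differentiableOn_besselRemainder_mul hc hc1 hκ hcκ))
    (fun r hr => by
      obtain ⟨k1, k2⟩ := hb κ hκ hcκ r hr
      refine (norm_add_le _ _).trans ((add_le_add k2 k1).trans (le_of_eq ?_))
      ring) x hx
  obtain ⟨s₂, b₂⟩ := h₂ (fun r => besselRemainder (κ * r)) (B / (1 + ‖κ‖ ^ 2))
    (differentiableOn_besselRemainder_mul hc hc1 hκ hcκ) (fun r hr => (hb κ hκ hcκ r hr).1) x hx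
  have e : stokesProfile κ α β = fun y : Plane => d * besselMoment 0 κ
      + (d * (besselMoment 0 (κ * (‖y‖ : ℝ)) - besselMoment 0 κ + besselRemainder (κ * (‖y‖ : ℝ)))
        + -(1 / (2 * Real.pi) : ℂ) * ((y α * y β / ‖y‖ ^ 2 : ℝ) : ℂ)
          * besselRemainder (κ * (‖y‖ : ℝ))) := by
    funext y
    have hd' : d = 1 / (2 * Real.pi) * (if α = β then 1 else 0) / 2 := by rw [hd]; ring
    rw [stokesProfile, hd']
    ring
  rw [e, fun_iteratedFDeriv_add_apply contDiffAt_const (s₁.add s₂), iteratedFDeriv_const_of_ne hℓ,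
    Pi.zero_apply, zero_add, fun_iteratedFDeriv_add_apply s₁ s₂]
  refine (norm_add_le _ _).trans ((add_le_add b₁ b₂).trans ?_)
  rw [← mul_div_assoc, ← mul_div_assoc, ← add_div]
  exact div_le_div_of_nonneg_right (by linarith) (by positivity)

theorem stokesProfile_smul {κ : ℂ} {ρ : ℝ} (hρ : 0 < ρ) (α β : Fin 2) (y : Plane) :
    stokesProfile κ α β y = stokesProfile (κ * ρ) α β (ρ⁻¹ • y) := by
  have hn : ‖ρ⁻¹ • y‖ = ρ⁻¹ * ‖y‖ := by
    rw [norm_smul, Real.norm_of_nonneg (inv_nonneg.2 hρ.le)]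
  have hρ' : (ρ : ℂ) ≠ 0 := by exact_mod_cast hρ.ne'
  have h1 : κ * ρ * ((ρ⁻¹ * ‖y‖ : ℝ) : ℂ) = κ * (‖y‖ : ℝ) := by
    push_cast
    field_simp
  have h2 : (ρ⁻¹ • y) α * (ρ⁻¹ • y) β / (ρ⁻¹ * ‖y‖) ^ 2 = y α * y β / ‖y‖ ^ 2 := by
    rw [PiLp.smul_apply, PiLp.smul_apply, smul_eq_mul, smul_eq_mul,
      show ρ⁻¹ * y α * (ρ⁻¹ * y β) = ρ⁻¹ ^ 2 * (y α * y β) by ring, mul_pow,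
      mul_div_mul_left _ _ (by positivity)]
  rw [stokesProfile, stokesProfile, hn, h1, h2]

theorem exists_norm_iteratedFDeriv_stokesProfile_le {c : ℝ} (hc : 0 < c) (hc1 : c ≤ 1)
    {ℓ : ℕ} (hℓ : ℓ ≠ 0) (α β : Fin 2) :
    ∃ C : ℝ, 0 < C ∧ ∀ κ : ℂ, 0 < κ.re → c * ‖κ‖ ≤ κ.re → ∀ x : Plane, x ≠ 0 →
      ‖iteratedFDeriv ℝ ℓ (stokesProfile κ α β) x‖
        ≤ C / ((1 + ‖κ‖ ^ 2 * ‖x‖ ^ 2) * ‖x‖ ^ ℓ) := by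
  obtain ⟨C, hC, h⟩ := exists_norm_iteratedFDeriv_stokesProfile_le_on_sphere hc hc1 hℓ α β
  refine ⟨C, hC, fun κ hκ hcκ x hx => ?_⟩
  have hρ : 0 < ‖x‖ := norm_pos_iff.2 hx
  have hκn : ‖κ * (‖x‖ : ℝ)‖ = ‖κ‖ * ‖x‖ := by simp
  have hκr : (κ * (‖x‖ : ℝ)).re = κ.re * ‖x‖ := by simp
  have hκ' : 0 < (κ * (‖x‖ : ℝ)).re := by rw [hκr]; positivity
  have hux : ‖‖x‖⁻¹ • x‖ = 1 := by rw [norm_smul, norm_inv, norm_norm, inv_mul_cancel₀ hρ.ne']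
  have hb := h (κ * (‖x‖ : ℝ)) hκ' (by rw [hκn, hκr, ← mul_assoc]; gcongr) (‖x‖⁻¹ • x) hux
  rw [hκn, mul_pow] at hb
  let L : Plane →L[ℝ] Plane := ‖x‖⁻¹ • ContinuousLinearMap.id ℝ Plane
  have hL : ‖L‖ ≤ ‖x‖⁻¹ := by
    refine ContinuousLinearMap.opNorm_le_bound _ (by positivity) fun y => ?_
    simp [L, norm_smul]
  have hx0 : (L ⁻¹' {0}ᶜ : Set Plane) = {0}ᶜ := by
    ext y
    simp [L, hx]
  have ho : IsOpen ({0}ᶜ : Set Plane) := isOpen_compl_singleton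
  have hLx : L x ∈ ({0}ᶜ : Set Plane) := by
    rw [← mem_preimage, hx0]; exact hx
  have key := L.iteratedFDerivWithin_comp_right (i := ℓ)
    (contDiffOn_stokesProfile hκ' α β) ho.uniqueDiffOn (by rw [hx0]; exact ho.uniqueDiffOn)
    hLx (by exact_mod_cast le_top)
  rw [hx0, iteratedFDerivWithin_of_isOpen ℓ ho hx, iteratedFDerivWithin_of_isOpen ℓ ho hLx,
    show stokesProfile (κ * (‖x‖ : ℝ)) α β ∘ L = stokesProfile κ α β from
      funext fun y => (stokesProfile_smul hρ α β y).symm] at key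
  rw [key]
  refine (ContinuousMultilinearMap.norm_compContinuousLinearMap_le _ _).trans ?_
  rw [Finset.prod_const, Finset.card_univ, Fintype.card_fin]
  calc _ ≤ C / (1 + ‖κ‖ ^ 2 * ‖x‖ ^ 2) * (‖x‖⁻¹) ^ ℓ := by gcongr; exact hb
    _ = _ := by rw [inv_pow, ← div_eq_mul_inv, div_div]

theorem image_cosh_sub_one_div_two :
    (fun u : ℝ => (Real.cosh u - 1) / 2) '' Ioi 0 = Ioi 0 := by
  ext s
  constructor
  · rintro ⟨u, hu, rfl⟩
    have : 1 < Real.cosh u := Real.one_lt_cosh.2 (ne_of_gt hu)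
    simp only [mem_Ioi]
    linarith
  · intro hs
    rw [mem_Ioi] at hs
    refine ⟨Real.arcosh (2 * s + 1), Real.arcosh_pos (by linarith), ?_⟩
    simp only
    rw [Real.cosh_arcosh (by linarith)]
    ring

/-- The Hankel function of order zero at `i w` as an integral with respect to the hyperbolic
angle. -/
theorem hankelOne_zero_I_mul (w : ℂ) :
    hankelOne 0 (Complex.I * w) = 2 / (Complex.I * Real.pi) * besselMoment 0 w := by
  have hsub := integral_image_eq_integral_abs_deriv_smul (s := Ioi (0 : ℝ))
    (f := fun u : ℝ => (Real.cosh u - 1) / 2) (f' := fun u => Real.sinh u / 2)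
    measurableSet_Ioi
    (fun u _ => (((Real.hasDerivAt_cosh u).sub_const 1).div_const 2).hasDerivWithinAt)
    (fun u hu v hv h => by
      have h' : Real.cosh u = Real.cosh v := by
        simp only at h
        linarith
      exact Real.cosh_strictMonoOn.injOn (Ioi_subset_Ici_self hu) (Ioi_subset_Ici_self hv) h')
    (fun s : ℝ => Complex.exp (2 * (Complex.I * w) * Complex.I * (s : ℂ))
          * ((s ^ ((0 : ℝ) - 1 / 2) * (1 + s) ^ ((0 : ℝ) - 1 / 2) : ℝ) : ℂ))
  rw [image_cosh_sub_one_div_two] at hsub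
  have hint : ∀ u ∈ Ioi (0 : ℝ), |Real.sinh u / 2| •
      (Complex.exp (2 * (Complex.I * w) * Complex.I * (((Real.cosh u - 1) / 2 : ℝ) : ℂ))
        * ((((Real.cosh u - 1) / 2) ^ ((0 : ℝ) - 1 / 2)
          * (1 + (Real.cosh u - 1) / 2) ^ ((0 : ℝ) - 1 / 2) : ℝ) : ℂ))
      = Complex.exp w * ((Real.cosh u : ℂ) ^ 0 * Complex.exp (-w * Real.cosh u)) := by
    intro u hu
    have hs : 0 < Real.sinh u := Real.sinh_pos_iff.2 hu
    have hc : 1 < Real.cosh u := Real.one_lt_cosh.2 (ne_of_gt hu)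
    have hpow : ((Real.cosh u - 1) / 2) ^ ((0 : ℝ) - 1 / 2)
          * (1 + (Real.cosh u - 1) / 2) ^ ((0 : ℝ) - 1 / 2) = (Real.sinh u / 2)⁻¹ := by
      rw [← Real.mul_rpow (by linarith) (by linarith),
        show (Real.cosh u - 1) / 2 * (1 + (Real.cosh u - 1) / 2) = (Real.sinh u / 2) ^ 2 by
          have := Real.cosh_sq_sub_sinh_sq u
          linear_combination this / 4,
        zero_sub, Real.rpow_neg (by positivity), ← Real.sqrt_eq_rpow,
        Real.sqrt_sq (by positivity)]
    have hexp : 2 * (Complex.I * w) * Complex.I * (((Real.cosh u - 1) / 2 : ℝ) : ℂ)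
        = w + -w * Real.cosh u := by
      push_cast
      linear_combination (w * (Complex.cosh u - 1)) * Complex.I_sq
    rw [hpow, hexp, Complex.exp_add, abs_of_pos (by positivity), Complex.real_smul, pow_zero,
      one_mul, mul_left_comm, ← Complex.ofReal_mul, mul_inv_cancel₀ (by positivity),
      Complex.ofReal_one, mul_one]
  rw [setIntegral_congr_fun measurableSet_Ioi hint, integral_const_mul] at hsub
  rw [hankelOne, hsub]
  have hπ : (Real.sqrt Real.pi : ℂ) * (Real.Gamma (0 + 1 / 2) : ℂ) = Real.pi := by
    rw [zero_add, Real.Gamma_one_half_eq, ← Complex.ofReal_mul,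
      Real.mul_self_sqrt Real.pi_pos.le]
  have hexp : Complex.exp (Complex.I * (Complex.I * w - ((0 : ℝ) : ℂ) * (Real.pi : ℂ)))
      * Complex.exp w = 1 := by
    rw [← Complex.exp_add, Complex.ofReal_zero, zero_mul, sub_zero, ← mul_assoc, Complex.I_mul_I]
    simp
  have h2 : (2 : ℂ) ^ (((0 : ℝ) : ℂ) + 1) = 2 := by simp
  have hz : (Complex.I * w) ^ ((0 : ℝ) : ℂ) = 1 := by simp
  rw [mul_assoc Complex.I, hπ, h2, hz, mul_one, besselMoment]
  linear_combination (2 / (Complex.I * Real.pi)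
    * ∫ u in Ioi (0 : ℝ), (Real.cosh u : ℂ) ^ 0 * Complex.exp (-w * Real.cosh u)) * hexp

/-- The principal square root `√r exp (i τ / 2)` of `lam = r exp (i τ)`. -/
noncomputable def sqrtParam (lam : ℂ) : ℂ :=
  (Real.sqrt ‖lam‖ : ℂ) * Complex.exp ((lam.arg / 2 : ℝ) * Complex.I)

theorem waveNumber_eq (lam : ℂ) : waveNumber lam = Complex.I * sqrtParam lam := by
  have : Complex.I * ((Real.pi + lam.arg : ℝ) : ℂ) / 2
      = Real.pi / 2 * Complex.I + (lam.arg / 2 : ℝ) * Complex.I := by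
    push_cast
    ring
  rw [waveNumber, sqrtParam, this, Complex.exp_add, Complex.exp_pi_div_two_mul_I]
  ring

theorem norm_sqrtParam (lam : ℂ) : ‖sqrtParam lam‖ = Real.sqrt ‖lam‖ := by
  rw [sqrtParam, norm_mul, Complex.norm_exp_ofReal_mul_I, mul_one, Complex.norm_real,
    Real.norm_of_nonneg (Real.sqrt_nonneg _)]

theorem sqrtParam_sq (lam : ℂ) : sqrtParam lam ^ 2 = lam := by
  rw [sqrtParam, mul_pow, ← Complex.ofReal_pow, Real.sq_sqrt (norm_nonneg _), ← Complex.exp_nat_mul]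
  convert Complex.norm_mul_exp_arg_mul_I lam using 3
  push_cast
  ring

theorem sin_mul_norm_sqrtParam_le {θ : ℝ} (hθ : 0 < θ) {lam : ℂ} (hlam : lam ∈ sector θ) :
    Real.sin (θ / 2) * ‖sqrtParam lam‖ ≤ (sqrtParam lam).re := by
  have hre : (sqrtParam lam).re = Real.sqrt ‖lam‖ * Real.cos (lam.arg / 2) := by
    rw [sqrtParam, Complex.re_ofReal_mul, Complex.exp_ofReal_mul_I_re]
  rw [norm_sqrtParam, hre, mul_comm]
  refine mul_le_mul_of_nonneg_left ?_ (Real.sqrt_nonneg _)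
  rw [← Real.cos_pi_div_two_sub, ← Real.cos_abs (lam.arg / 2), abs_div, abs_two]
  have h := hlam.2
  have h0 := abs_nonneg lam.arg
  refine Real.cos_le_cos_of_nonneg_of_le_pi (by linarith) ?_ (by linarith)
  linarith [Real.pi_pos]

theorem helmholtzFund_eq (lam : ℂ) (y : Plane) :
    helmholtzFund lam y = 1 / (2 * Real.pi) * besselMoment 0 (sqrtParam lam * (‖y‖ : ℝ)) := by
  rw [helmholtzFund, waveNumber_eq, mul_assoc, hankelOne_zero_I_mul]
  have hπ : (Real.pi : ℂ) ≠ 0 := by exact_mod_cast Real.pi_ne_zero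
  field_simp
  norm_num

theorem hasFDerivAt_norm_of_ne_zero {y : Plane} (hy : y ≠ 0) :
    HasFDerivAt (fun y : Plane => ‖y‖) (‖y‖⁻¹ • innerSL ℝ y) y := by
  have h := (hasStrictFDerivAt_norm_sq y).hasFDerivAt.sqrt
    (pow_ne_zero 2 (norm_ne_zero_iff.2 hy))
  simp only [Real.sqrt_sq (norm_nonneg _)] at h
  convert! h using 1
  ext v
  simp
  field_simp

theorem partialDeriv_radial_mul {φ : ℝ → ℂ} {φ' : ℂ} {y : Plane} (hy : y ≠ 0)
    (hφ : HasDerivAt φ φ' ‖y‖) {f : Plane → ℂ} {f' : Plane →L[ℝ] ℂ} (hf : HasFDerivAt f f' y)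
    (α : Fin 2) :
    partialDeriv α (fun y => φ ‖y‖ * f y) y
      = φ ‖y‖ * f' (EuclideanSpace.single α 1) + φ' * (y α / ‖y‖ : ℝ) * f y := by
  have h := (hφ.hasFDerivAt.comp y (hasFDerivAt_norm_of_ne_zero hy)).mul hf
  rw [partialDeriv]
  erw [h.fderiv]
  simp [EuclideanSpace.inner_single_right]
  ring

theorem partialDeriv_helmholtzFund_sub_laplaceFund {lam : ℂ} (hlam : 0 < (sqrtParam lam).re)
    {y : Plane} (hy : y ≠ 0) (β : Fin 2) :
    partialDeriv β (fun y => helmholtzFund lam y - laplaceFund y) y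
      = lam / (4 * Real.pi) * (besselMoment 0 (sqrtParam lam * (‖y‖ : ℝ))
          - besselRemainder (sqrtParam lam * (‖y‖ : ℝ))) * y β := by
  set κ := sqrtParam lam with hκ
  have hρ : 0 < ‖y‖ := norm_pos_iff.2 hy
  have hw : 0 < (κ * (‖y‖ : ℝ)).re := by rw [Complex.re_mul_ofReal]; positivity
  have h1 : HasDerivAt (fun r : ℝ => besselMoment 0 (κ * r))
      (-besselMoment 1 (κ * (‖y‖ : ℝ)) * κ) ‖y‖ := by
    have h := (HasDerivAt.comp ((‖y‖ : ℝ) : ℂ) (hasDerivAt_besselMoment 0 hw)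
      ((hasDerivAt_id ((‖y‖ : ℝ) : ℂ)).const_mul κ)).comp_ofReal
    rw [mul_one] at h
    exact h
  have h2 : HasDerivAt (fun r : ℝ => ((Real.log r : ℝ) : ℂ)) ((‖y‖⁻¹ : ℝ) : ℂ) ‖y‖ :=
    (Real.hasDerivAt_log hρ.ne').ofReal_comp
  have h := partialDeriv_radial_mul hy ((h1.add h2).const_mul (1 / (2 * Real.pi) : ℂ))
    (hasFDerivAt_const (1 : ℂ) y) β
  have e : (fun y => helmholtzFund lam y - laplaceFund y) = fun y : Plane =>
      (1 / (2 * Real.pi) : ℂ) * ((fun r : ℝ => besselMoment 0 (κ * r))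
        + fun r : ℝ => ((Real.log r : ℝ) : ℂ)) ‖y‖ * 1 := by
    funext y
    rw [helmholtzFund_eq, laplaceFund, Pi.add_apply]
    push_cast
    ring
  rw [e, h, besselRemainder, ← sqrtParam_sq lam, ← hκ]
  have hκ0 : κ ≠ 0 := by rintro h0; rw [h0] at hlam; simp at hlam
  have hρ' : ((‖y‖ : ℝ) : ℂ) ≠ 0 := by exact_mod_cast hρ.ne'
  have hπ : (Real.pi : ℂ) ≠ 0 := by exact_mod_cast Real.pi_ne_zero
  simp only [zero_apply, mul_zero, zero_add, mul_one]
  push_cast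
  field_simp
  ring

theorem hasDerivAt_besselMoment_sub_besselRemainder {w : ℂ} (hw : 0 < w.re) :
    HasDerivAt (fun w => besselMoment 0 w - besselRemainder w) (2 * besselRemainder w / w) w := by
  have hw0 : w ≠ 0 := by rintro rfl; simp at hw
  have e : (fun w => besselMoment 0 w - besselRemainder w)
      = fun w => 2 * ((1 - w * besselMoment 1 w) / w ^ 2) := by
    funext w
    rw [besselRemainder]
    ring
  have h := ((((hasDerivAt_id w).mul (hasDerivAt_besselMoment 1 hw)).const_sub 1).div
    (hasDerivAt_pow 2 w) (pow_ne_zero 2 hw0)).const_mul (2 : ℂ)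
  rw [e]
  convert! h using 1
  have hode := besselMoment_one_eq hw
  rw [besselRemainder]
  simp only [id_eq, Pi.mul_apply]
  field_simp
  push_cast
  linear_combination w ^ 2 * hode

theorem stokesFund_eq_stokesProfile {lam : ℂ} (hlam : 0 < (sqrtParam lam).re) {x : Plane}
    (hx : x ≠ 0) (α β : Fin 2) :
    stokesFund lam x α β = stokesProfile (sqrtParam lam) α β x := by
  have hρ : 0 < ‖x‖ := norm_pos_iff.2 hx
  have hev : partialDeriv β (fun y => helmholtzFund lam y - laplaceFund y) =ᶠ[𝓝 x]
      fun y : Plane => lam / (4 * Real.pi) * (besselMoment 0 (sqrtParam lam * (‖y‖ : ℝ))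
          - besselRemainder (sqrtParam lam * (‖y‖ : ℝ))) * y β := by
    filter_upwards [isOpen_compl_singleton.mem_nhds hx] with y hy
    exact partialDeriv_helmholtzFund_sub_laplaceFund hlam hy β
  have hlam0 : lam ≠ 0 := by
    rintro rfl
    simp [sqrtParam] at hlam
  have hsq := sqrtParam_sq lam
  set κ := sqrtParam lam with hκ
  have hw : 0 < (κ * (‖x‖ : ℝ)).re := by rw [Complex.re_mul_ofReal]; positivity
  have h1 : HasDerivAt (fun r : ℝ => besselMoment 0 (κ * r) - besselRemainder (κ * r))
      (2 * besselRemainder (κ * (‖x‖ : ℝ)) / (κ * (‖x‖ : ℝ)) * κ) ‖x‖ := by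
    have h := (HasDerivAt.comp ((‖x‖ : ℝ) : ℂ) (hasDerivAt_besselMoment_sub_besselRemainder hw)
      ((hasDerivAt_id ((‖x‖ : ℝ) : ℂ)).const_mul κ)).comp_ofReal
    rw [mul_one] at h
    exact h
  have hproj : HasFDerivAt (fun y : Plane => ((y β : ℝ) : ℂ))
      (Complex.ofRealCLM.comp (EuclideanSpace.proj (𝕜 := ℝ) β)) x :=
    (Complex.ofRealCLM.comp (EuclideanSpace.proj (𝕜 := ℝ) β)).hasFDerivAt
  have h := partialDeriv_radial_mul hx (h1.const_mul (lam / (4 * Real.pi) : ℂ)) hproj α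
  have hsingle : (Complex.ofRealCLM.comp (EuclideanSpace.proj (𝕜 := ℝ) β))
      (EuclideanSpace.single α (1 : ℝ)) = if α = β then (1 : ℂ) else 0 := by
    by_cases hab : α = β
    · simp [hab]
    · simp [hab, Ne.symm hab]
  have hκ0 : κ ≠ 0 := by rintro h0; rw [h0] at hlam; simp at hlam
  have hρ' : ((‖x‖ : ℝ) : ℂ) ≠ 0 := by exact_mod_cast hρ.ne'
  have hπ : (Real.pi : ℂ) ≠ 0 := by exact_mod_cast Real.pi_ne_zero
  rw [hsingle] at h
  rw [stokesFund, Matrix.of_apply, helmholtzFund_eq, stokesProfile, ← hκ]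
  have hpd : partialDeriv α (partialDeriv β fun y => helmholtzFund lam y - laplaceFund y) x
      = partialDeriv α (fun y : Plane => lam / (4 * Real.pi)
        * (besselMoment 0 (κ * (‖y‖ : ℝ)) - besselRemainder (κ * (‖y‖ : ℝ))) * y β) x := by
    rw [partialDeriv, hev.fderiv_eq, partialDeriv]
  rw [hpd, h]
  push_cast
  field_simp
  ring

end StokesResolvent

theorem mainTheorem10 (θ : ℝ) (hθ : 0 < θ) (hθ' : θ < Real.pi / 2) (ℓ : ℕ) (hℓ : 1 ≤ ℓ) :
    ∃ C : ℝ, 0 < C ∧ ∀ lam : ℂ, lam ∈ StokesResolvent.sector θ → ∀ α β : Fin 2,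
      ContDiffOn ℝ ∞ (fun y : StokesResolvent.Plane => StokesResolvent.stokesFund lam y α β)
          {0}ᶜ ∧
        ∀ x : StokesResolvent.Plane, x ≠ 0 →
          ‖iteratedFDeriv ℝ ℓ
              (fun y : StokesResolvent.Plane => StokesResolvent.stokesFund lam y α β) x‖
            ≤ C / ((1 + ‖lam‖ * ‖x‖ ^ 2) * ‖x‖ ^ ℓ) := by
  have hc : 0 < Real.sin (θ / 2) := Real.sin_pos_of_pos_of_lt_pi (by linarith) (by linarith)
  choose C hC h using fun α β => StokesResolvent.exists_norm_iteratedFDeriv_stokesProfile_le hc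
    (Real.sin_le_one _) (Nat.one_le_iff_ne_zero.1 hℓ) α β
  refine ⟨∑ α, ∑ β, C α β, Finset.sum_pos (fun α _ => Finset.sum_pos (fun β _ => hC α β)
    Finset.univ_nonempty) Finset.univ_nonempty, fun lam hlam α β => ?_⟩
  have hcκ := StokesResolvent.sin_mul_norm_sqrtParam_le hθ hlam
  have hn : 0 < ‖StokesResolvent.sqrtParam lam‖ := by
    rw [StokesResolvent.norm_sqrtParam]
    exact Real.sqrt_pos.2 (norm_pos_iff.2 hlam.1)
  have hκ : 0 < (StokesResolvent.sqrtParam lam).re := lt_of_lt_of_le (by positivity) hcκ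
  refine ⟨(StokesResolvent.contDiffOn_stokesProfile hκ α β).congr fun y hy =>
    StokesResolvent.stokesFund_eq_stokesProfile hκ hy α β, fun x hx => ?_⟩
  have hev : (fun y : StokesResolvent.Plane => StokesResolvent.stokesFund lam y α β)
      =ᶠ[nhds x] StokesResolvent.stokesProfile (StokesResolvent.sqrtParam lam) α β := by
    filter_upwards [isOpen_compl_singleton.mem_nhds hx] with y hy
    exact StokesResolvent.stokesFund_eq_stokesProfile hκ hy α β
  rw [(hev.iteratedFDeriv ℝ ℓ).eq_of_nhds]
  refine (h α β _ hκ hcκ x hx).trans ?_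
  rw [StokesResolvent.norm_sqrtParam, Real.sq_sqrt (norm_nonneg _)]
  gcongr
  exact (Finset.single_le_sum (f := C α) (fun j _ => (hC α j).le) (Finset.mem_univ β)).trans
    (Finset.single_le_sum (f := fun i => ∑ j, C i j)
      (fun i _ => Finset.sum_nonneg fun j _ => (hC i j).le) (Finset.mem_univ α))
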